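/- Let $T=\mathbb{R}^2/\mathbb{Z}^2$ be the closed oriented surface of genus one, let $\hat\pi$ be the set of free homotopy classes of loops on $T$, and let $\mathfrak{G}=\mathbb{Z}\hat\pi$ be the free $\mathbb{Z}$-module with basis $\hat\pi$. For $\alpha,\beta\in\hat\pi$ the Goldman bracket is $$[\alpha,\beta]=\sum_{p}\epsilon(p)\,\alpha *_p\beta ,$$ where the sum runs over the (finitely many) intersections $p$ of two smooth loops that represent $\alpha$ and $\beta$ and intersect transversally, $\epsilon(p)=\pm1$ is the sign of the intersection (it is $1$ if the tangent vectors of the two loops at $p$, in this order, form a positively oriented basis), and $\alpha*_p\beta$ is the free homotopy class of the loop that starts at $p$, goes once around the first loop and then once around the second. The bracket is extended bilinearly to $\mathfrak{G}$. For $i,j\in\mathbb{Z}$ let $a^ib^j\in\hat\pi$ be the class of the loop $s\mapsto(is,js)$ on $T$, $s \in \mathbb{R}/\mathbb{Z}$, and write $a^n=a^nb^0$, $b^n=a^0b^n$. Transverse representatives exist for all $\alpha,\beta\in\hat\pi$, the bracket does not depend on their choice, and it makes $\mathfrak{G}$ a Lie algebra over $\mathbb{Z}$. The lower central series $G_0=\mathfrak{G}$,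 $G_{k+1}=[\mathfrak{G},G_k]$ of this Lie algebra stabilizes from the second term on: for every $k\ge 0$, $$G_{k+1}=[\mathfrak{G},G_k]=[\mathfrak{G},\mathfrak{G}]=\big\langle\, \gcd(i,j)\,a^ib^j,\; n\,a^n,\; n\,b^n \;:\; i,j\in\mathbb{Z},\ n\in\mathbb{Z}\setminus\{0\}\,\big\rangle ,$$ where $\langle\,\cdot\,\rangle$ denotes the $\mathbb{Z}$-span and $\gcd(0,0)=0$. In particular, $\mathfrak{G}$ is not nilpotent as a Lie algebra over $\mathbb{Z}$. -/

import Mathlib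

open scoped ContDiff

namespace Goldman

noncomputable section

/-! ### Free homotopy classes of loops -/

/-- The set of free homotopy classes of loops on a space `X`: continuous maps from the circle
`ℝ / ℤ` to `X`, up to homotopy (no base point is kept fixed). -/
def FreeLoopClass (X : Type*) [TopologicalSpace X] : Type _ :=
  Quotient (Setoid.mk (α := C(UnitAddCircle, X)) ContinuousMap.Homotopic
    ContinuousMap.Homotopic.equivalence)

/-- The free homotopy class of a loop. -/
def freeClass {X : Type*} [TopologicalSpace X] (γ : C(UnitAddCircle, X)) : FreeLoopClass X :=
  Quotient.mk _ γ

/-- A closed path, regarded as a map from the circle. -/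
def pathLoop {X : Type*} [TopologicalSpace X] {x : X} (γ : Path x x) : C(UnitAddCircle, X) where
  toFun := AddCircle.liftIco 1 0 γ.extend
  continuous_toFun := AddCircle.liftIco_continuous (by simp) γ.continuous_extend.continuousOn

/-! ### The torus and smooth loops on it -/

/-- The closed oriented surface of genus one, as `ℝ² / ℤ²`. -/
abbrev Torus : Type := UnitAddCircle × UnitAddCircle

/-- The universal covering `ℝ² → ℝ² / ℤ²`. The torus has the smooth structure and the orientation
for which this is an orientation preserving local diffeomorphism. -/
def torusProj (v : ℝ × ℝ) : Torus := ((v.1 : UnitAddCircle), (v.2 : UnitAddCircle))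

theorem continuous_torusProj : Continuous torusProj :=
  ((AddCircle.continuous_mk' 1).comp continuous_fst).prodMk
    ((AddCircle.continuous_mk' 1).comp continuous_snd)

/-- A smooth loop on the torus, given by a smooth lift `ℝ → ℝ²` whose projection to the torus has
period `1`. Every smooth map from the circle to the torus has such a lift. -/
structure SmoothLoop where
  lift : ℝ → ℝ × ℝ
  contDiff_lift : ContDiff ℝ ∞ lift
  periodic : Function.Periodic (fun s => torusProj (lift s)) 1

namespace SmoothLoop

/-- The underlying curve on the torus, as a function of a real parameter of period `1`. -/
def curve (α : SmoothLoop) (s : ℝ) : Torus := torusProj (α.lift s)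

theorem continuous_curve (α : SmoothLoop) : Continuous α.curve :=
  continuous_torusProj.comp α.contDiff_lift.continuous

/-- The underlying continuous loop. -/
def toLoop (α : SmoothLoop) : C(UnitAddCircle, Torus) where
  toFun := Function.Periodic.lift (f := α.curve) α.periodic
  continuous_toFun := continuous_coinduced_dom.mpr α.continuous_curve

/-- The free homotopy class of a smooth loop. -/
def cls (α : SmoothLoop) : FreeLoopClass Torus := freeClass α.toLoop

/-- The loop traversed once, starting and ending at the parameter value `s`. -/
def pathFrom (α : SmoothLoop) (s : ℝ) : Path (α.curve s) (α.curve s) where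
  toFun u := α.curve (s + u)
  continuous_toFun := α.continuous_curve.comp (by fun_prop)
  source' := by simp
  target' := by simpa using show α.curve (s + 1) = α.curve s from α.periodic s

/-- The intersections of two loops, as pairs of parameters in `[0, 1)`. -/
def crossings (α β : SmoothLoop) : Set (ℝ × ℝ) :=
  {p | p.1 ∈ Set.Ico (0 : ℝ) 1 ∧ p.2 ∈ Set.Ico (0 : ℝ) 1 ∧ α.curve p.1 = β.curve p.2}

/-- The determinant of the pair of velocity vectors of `α` at `s` and of `β` at `t`. -/
def velocityDet (α β : SmoothLoop) (s t : ℝ) : ℝ :=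
  (deriv α.lift s).1 * (deriv β.lift t).2 - (deriv α.lift s).2 * (deriv β.lift t).1

/-- Two loops intersect transversally: there are finitely many intersections, and at each of them
the two velocity vectors are linearly independent. -/
def Transverse (α β : SmoothLoop) : Prop :=
  (crossings α β).Finite ∧ ∀ p ∈ crossings α β, velocityDet α β p.1 p.2 ≠ 0

/-- The sign `ε(p) = ±1` of an intersection: it is `1` if the velocity vectors of `α` and of `β`,
in this order, form a positive basis of the tangent plane. -/
def crossingSign (α β : SmoothLoop) (p : crossings α β) : ℤ :=
  (SignType.sign (velocityDet α β p.1.1 p.1.2) : ℤ)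

/-- The loop product at an intersection `p`: go once around `α` starting at `p`, then once
around `β`. -/
def productAt (α β : SmoothLoop) (p : crossings α β) : C(UnitAddCircle, Torus) :=
  pathLoop ((α.pathFrom p.1.1).trans ((β.pathFrom p.1.2).cast p.2.2.2 p.2.2.2))

end SmoothLoop

/-! ### The Goldman bracket -/

/-- The free `ℤ`-module on the free homotopy classes of loops on the torus. -/
abbrev GoldmanModule : Type := FreeLoopClass Torus →₀ ℤ

/-- The basis element of a free homotopy class. -/
def basisElt (x : FreeLoopClass Torus) : GoldmanModule := Finsupp.single x 1

/-- The signed sum `∑ ε(p) α *ₚ β` over the intersections `p` of two loops. -/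
def intersectionSum (α β : SmoothLoop) : GoldmanModule :=
  ∑ᶠ p : SmoothLoop.crossings α β,
    SmoothLoop.crossingSign α β p • basisElt (freeClass (SmoothLoop.productAt α β p))

/-- `α` and `β` are transverse smooth loops in the free homotopy classes `x` and `y`. -/
def Represents (α β : SmoothLoop) (x y : FreeLoopClass Torus) : Prop :=
  α.Transverse β ∧ α.cls = x ∧ β.cls = y

open Classical in
/-- The Goldman bracket of two free homotopy classes: the signed sum over the intersections of
two transverse representatives. -/
def bracketOfClasses (x y : FreeLoopClass Torus) : GoldmanModule :=
  if h : ∃ r : SmoothLoop × SmoothLoop, Represents r.1 r.2 x y then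
    intersectionSum h.choose.1 h.choose.2
  else 0

/-- The Goldman bracket, extended bilinearly. -/
def goldmanBracket : GoldmanModule →ₗ[ℤ] GoldmanModule →ₗ[ℤ] GoldmanModule :=
  Finsupp.linearCombination ℤ fun x => Finsupp.linearCombination ℤ fun y => bracketOfClasses x y

/-- The Goldman bracket does not depend on the transverse representatives. -/
def BracketWellDefined : Prop :=
  ∀ x y : FreeLoopClass Torus, (∃ α β : SmoothLoop, Represents α β x y) ∧
    ∀ α β : SmoothLoop, Represents α β x y →
      goldmanBracket (basisElt x) (basisElt y) = intersectionSum α β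

/-- A bilinear map is alternating and satisfies the Jacobi identity. -/
structure IsLieBracket {M : Type*} [AddCommGroup M] (B : M →ₗ[ℤ] M →ₗ[ℤ] M) : Prop where
  self : ∀ x, B x x = 0
  jacobi : ∀ x y z, B x (B y z) + B y (B z x) + B z (B x y) = 0

/-- The Lie ring structure given by a bilinear Lie bracket. -/
abbrev IsLieBracket.lieRing {M : Type*} [inst : AddCommGroup M] {B : M →ₗ[ℤ] M →ₗ[ℤ] M}
    (h : IsLieBracket B) : LieRing M where
  toAddCommGroup := inst
  bracket x y := B x y
  add_lie x y z := by simp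
  lie_add x y z := by simp
  lie_self x := h.self x
  leibniz_lie x y z := by
    have skew : ∀ u v, B u v = -B v u := fun u v => by
      have := h.self (u + v)
      simp only [map_add, LinearMap.add_apply, h.self] at this
      rw [eq_neg_iff_add_eq_zero]
      simpa [add_comm] using this
    have hj := h.jacobi x y z
    change B x (B y z) = B (B x y) z + B y (B x z)
    rw [skew (B x y) z, skew x z, map_neg, ← sub_eq_zero, ← hj]
    abel

/-! ### The classes `aⁱbʲ` -/

/-- The smooth loop `s ↦ (i s, j s)` on the torus, winding `i` times around the first factor and
`j` times around the second. -/
def windingLoop (i j : ℤ) : SmoothLoop where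
  lift s := (i * s, j * s)
  contDiff_lift := by fun_prop
  periodic s := by
    simp [torusProj, mul_add]

/-- The element `aⁱbʲ`, where `a` and `b` are the classes of the two coordinate circles. -/
def word (i j : ℤ) : GoldmanModule := basisElt (windingLoop i j).cls

end

end Goldman

namespace Goldman

open MeasureTheory Filter Topology

noncomputable section

/-! ### Lifts and winding numbers -/

/-! Lifting loops to the plane identifies free homotopy classes with winding vectors in `ℤ²`. The
product of two loops at any crossing has the sum of their winding vectors, so in a bracket every
crossing contributes the same class and only the signed count of crossings matters. The outcome is
`goldmanBracket_word`: the coefficient is the determinant `i * l - j * k`.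

That count must be found for arbitrary transverse representatives. For lifts `A`, `B`, crossings are
the zeros of `(s, t) ↦ A s - B t` as a map of tori, and the count is its degree up to sign.
`integral_mul_cross_eq` computes the degree by integrating the pulled-back area form against
characters and passing to continuous functions by density; `exists_setIntegral_tent_mul_det`
evaluates the same integral on a tent function at the origin, which sees only the crossings.
`sum_sign_cross_eq` compares the two.

The rest is arithmetic. The determinant is divisible by `gcd(i + k, j + l)`, which bounds `[𝔊, 𝔊]`
from above. Conversely, Bézout writes `gcd(m, n) aᵐbⁿ` as the bracket of a word with a primitive
word; a primitive word is itself one of the generators, so induction keeps all generators in every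
term of the series. The class `a` is among them, hence no nilpotency. -/

theorem torusProj_add (v w : ℝ × ℝ) : torusProj (v + w) = torusProj v + torusProj w := rfl

theorem torusProj_sub (v w : ℝ × ℝ) : torusProj (v - w) = torusProj v - torusProj w := rfl

theorem torusProj_eq_zero_iff {v : ℝ × ℝ} :
    torusProj v = 0 ↔ ∃ m n : ℤ, v = ((m : ℝ), (n : ℝ)) := by
  simp only [torusProj, Prod.ext_iff, Prod.fst_zero, Prod.snd_zero, AddCircle.coe_eq_zero_iff,
    zsmul_eq_mul, mul_one]
  constructor
  · rintro ⟨⟨m, hm⟩, n, hn⟩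
    exact ⟨m, n, hm.symm, hn.symm⟩
  · rintro ⟨m, n, hm, hn⟩
    exact ⟨⟨m, hm.symm⟩, n, hn.symm⟩

theorem torusProj_intCast (m n : ℤ) : torusProj ((m : ℝ), (n : ℝ)) = 0 :=
  torusProj_eq_zero_iff.2 ⟨m, n, rfl⟩

theorem exists_torus_lift {X : Type*} [TopologicalSpace X] [SimplyConnectedSpace X]
    [LocallyPathConnectedSpace X] (f : X → Torus) (hf : Continuous f) :
    ∃ F : X → ℝ × ℝ, Continuous F ∧ ∀ x, torusProj (F x) = f x := by
  obtain ⟨x₀⟩ : Nonempty X := inferInstance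
  have key : ∀ g : C(X, UnitAddCircle), ∃ G : C(X, ℝ), ∀ x, ((G x : ℝ) : UnitAddCircle) = g x := by
    intro g
    obtain ⟨e₀, he⟩ := QuotientAddGroup.mk_surjective (g x₀)
    obtain ⟨G, ⟨-, hG⟩, -⟩ :=
      (AddCircle.isCoveringMap_coe (1 : ℝ)).existsUnique_continuousMap_lifts g x₀ e₀ he
    exact ⟨G, fun x => congrFun hG x⟩
  obtain ⟨F, hF⟩ := key ⟨fun x => (f x).1, by fun_prop⟩
  obtain ⟨G, hG⟩ := key ⟨fun x => (f x).2, by fun_prop⟩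
  exact ⟨fun x => (F x, G x), by fun_prop, fun x => Prod.ext (hF x) (hG x)⟩

/-- After an integer translation the two lifts agree at one point, and lifts along a covering from a
connected space are determined by one value. -/
theorem torus_lift_unique {X : Type*} [TopologicalSpace X] [PreconnectedSpace X] [Nonempty X]
    {F G : X → ℝ × ℝ} (hF : Continuous F) (hG : Continuous G)
    (h : ∀ x, torusProj (F x) = torusProj (G x)) :
    ∃ m n : ℤ, ∀ x, F x = G x + ((m : ℝ), (n : ℝ)) := by
  obtain ⟨x₀⟩ : Nonempty X := inferInstance
  obtain ⟨m, n, hmn⟩ : ∃ m n : ℤ, F x₀ - G x₀ = ((m : ℝ), (n : ℝ)) := by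
    rw [← torusProj_eq_zero_iff, torusProj_sub, h, sub_self]
  have key : ∀ f g : X → ℝ, Continuous f → Continuous g →
      (∀ x, (f x : UnitAddCircle) = (g x : UnitAddCircle)) → f x₀ = g x₀ → f = g :=
    fun f g hf hg hfg h₀ =>
      (AddCircle.isCoveringMap_coe (1 : ℝ)).eq_of_comp_eq hf hg (funext hfg) x₀ h₀
  have hm : ((m : ℝ) : UnitAddCircle) = 0 := congrArg Prod.fst (torusProj_intCast m n)
  have hn : ((n : ℝ) : UnitAddCircle) = 0 := congrArg Prod.snd (torusProj_intCast m n)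
  have h₀ : F x₀ = G x₀ + ((m : ℝ), (n : ℝ)) := by rw [← hmn]; abel
  have h1 := key (fun x => (F x).1) (fun x => (G x).1 + m) (by fun_prop) (by fun_prop)
    (fun x => by rw [AddCircle.coe_add, hm, add_zero]; exact congrArg Prod.fst (h x))
    (congrArg Prod.fst h₀)
  have h2 := key (fun x => (F x).2) (fun x => (G x).2 + n) (by fun_prop) (by fun_prop)
    (fun x => by rw [AddCircle.coe_add, hn, add_zero]; exact congrArg Prod.snd (h x))
    (congrArg Prod.snd h₀)
  exact ⟨m, n, fun x => Prod.ext (congrFun h1 x) (congrFun h2 x)⟩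

/-- The loop `γ` on the torus winds `i` times around the first factor and `j` times around the
second. -/
def HasWinding (γ : C(UnitAddCircle, Torus)) (i j : ℤ) : Prop :=
  ∃ f : ℝ → ℝ × ℝ, Continuous f ∧ (∀ s : ℝ, torusProj (f s) = γ s) ∧
    ∀ s, f (s + 1) = f s + ((i : ℝ), (j : ℝ))

theorem exists_hasWinding_of_lift {γ : C(UnitAddCircle, Torus)} {f : ℝ → ℝ × ℝ}
    (hf : Continuous f) (hγ : ∀ s : ℝ, torusProj (f s) = γ s) :
    ∃ i j : ℤ, ∀ s, f (s + 1) = f s + ((i : ℝ), (j : ℝ)) :=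
  torus_lift_unique (by fun_prop) hf fun s => by simp [hγ]

theorem exists_hasWinding (γ : C(UnitAddCircle, Torus)) : ∃ i j : ℤ, HasWinding γ i j := by
  obtain ⟨f, hf, hγ⟩ := exists_torus_lift (fun s : ℝ => γ (s : UnitAddCircle))
    (γ.continuous.comp (AddCircle.continuous_mk' 1))
  obtain ⟨i, j, h⟩ := exists_hasWinding_of_lift hf hγ
  exact ⟨i, j, f, hf, hγ, h⟩

/-- Equal winding makes the difference of the lifts periodic, so it descends to an `ℝ²`-valued map
on the circle. Scaling that map from 0 to 1 and adding it to `γ` in the group `T` gives the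
homotopy. -/
theorem HasWinding.homotopic {γ γ' : C(UnitAddCircle, Torus)} {i j : ℤ}
    (h : HasWinding γ i j) (h' : HasWinding γ' i j) : γ.Homotopic γ' := by
  obtain ⟨f, hf, hγ, hp⟩ := h
  obtain ⟨f', hf', hγ', hp'⟩ := h'
  have hper : Function.Periodic (fun s => f' s - f s) 1 := fun s => by simp [hp, hp']
  let d : C(UnitAddCircle, ℝ × ℝ) :=
    ⟨hper.lift, continuous_coinduced_dom.mpr (by
      change Continuous fun s => f' s - f s
      fun_prop)⟩
  have hd : ∀ s : ℝ, d s = f' s - f s := fun s => rfl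
  refine ⟨⟨⟨fun x => γ x.2 + torusProj ((x.1 : ℝ) • d x.2), ?_⟩, fun x => ?_, fun x => ?_⟩⟩
  · exact (γ.continuous.comp continuous_snd).add (continuous_torusProj.comp (by fun_prop))
  · have h0 : torusProj 0 = 0 := rfl
    simp [h0]
  · obtain ⟨s, rfl⟩ := QuotientAddGroup.mk_surjective x
    change γ (s : UnitAddCircle) + torusProj (((1 : unitInterval) : ℝ) • d (s : UnitAddCircle)) =
      γ' (s : UnitAddCircle)
    rw [hd, ← hγ, ← hγ', ← torusProj_add]
    simp

/-- The lifted homotopy, shifted by one period, differs from itself by a constant integer vector;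
both end loops read their winding off that same constant. -/
theorem HasWinding.eq_of_homotopic {γ γ' : C(UnitAddCircle, Torus)} {i j i' j' : ℤ}
    (h : HasWinding γ i j) (h' : HasWinding γ' i' j') (H : γ.Homotopic γ') : i = i' ∧ j = j' := by
  obtain ⟨H⟩ := H
  -- `Set.projIcc` extends the homotopy constantly beyond `[0, 1]`, so that its domain is the whole
  -- plane.
  obtain ⟨F, hF, hFH⟩ := exists_torus_lift
    (fun x : ℝ × ℝ => H (Set.projIcc 0 1 zero_le_one x.1, (x.2 : UnitAddCircle)))
    (H.continuous.comp ((continuous_projIcc.comp continuous_fst).prodMk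
      ((AddCircle.continuous_mk' 1).comp continuous_snd)))
  obtain ⟨m, n, hmn⟩ := torus_lift_unique (F := fun x : ℝ × ℝ => F (x.1, x.2 + 1)) (G := F)
    (by fun_prop) hF (fun x => by simp [hFH])
  have key : ∀ (t : ℝ) (δ : C(UnitAddCircle, Torus)) (k l : ℤ), HasWinding δ k l →
      (∀ s : ℝ, torusProj (F (t, s)) = δ s) → m = k ∧ n = l := by
    rintro t δ k l ⟨f, hf, hδ, hp⟩ hFδ
    obtain ⟨a, b, hab⟩ := torus_lift_unique (F := fun s : ℝ => F (t, s)) (G := f)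
      (by fun_prop) hf (fun s => by rw [hδ, hFδ])
    have h1 := hmn (t, 0)
    have h2 := hab 0
    have h3 := hab (0 + 1)
    simp only at h1 h2 h3
    rw [h1, h2, hp] at h3
    simp only [Prod.ext_iff, Prod.fst_add, Prod.snd_add] at h3
    constructor
    · have := h3.1
      have : (m : ℝ) = k := by linarith
      exact_mod_cast this
    · have := h3.2
      have : (n : ℝ) = l := by linarith
      exact_mod_cast this
  obtain ⟨h1, h2⟩ := key 0 γ i j h (fun s => by simp [hFH])
  obtain ⟨h3, h4⟩ := key 1 γ' i' j' h' (fun s => by simp [hFH])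
  exact ⟨h1.symm.trans h3, h2.symm.trans h4⟩

theorem SmoothLoop.hasWinding_toLoop {α : SmoothLoop} {i j : ℤ}
    (h : ∀ s, α.lift (s + 1) = α.lift s + ((i : ℝ), (j : ℝ))) : HasWinding α.toLoop i j :=
  ⟨α.lift, α.contDiff_lift.continuous, fun _ => rfl, h⟩

theorem windingLoop_lift_add_one (i j : ℤ) (s : ℝ) :
    (windingLoop i j).lift (s + 1) = (windingLoop i j).lift s + ((i : ℝ), (j : ℝ)) := by
  simp [windingLoop, mul_add]

theorem hasWinding_windingLoop (i j : ℤ) : HasWinding (windingLoop i j).toLoop i j :=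
  SmoothLoop.hasWinding_toLoop (windingLoop_lift_add_one i j)

theorem HasWinding.freeClass_eq {γ : C(UnitAddCircle, Torus)} {i j : ℤ} (h : HasWinding γ i j) :
    freeClass γ = (windingLoop i j).cls :=
  Quotient.sound (h.homotopic (hasWinding_windingLoop i j))

theorem HasWinding.basisElt_eq {γ : C(UnitAddCircle, Torus)} {i j : ℤ} (h : HasWinding γ i j) :
    basisElt (freeClass γ) = word i j := by
  rw [h.freeClass_eq, word]

theorem exists_windingLoop_cls_eq (x : FreeLoopClass Torus) :
    ∃ i j : ℤ, (windingLoop i j).cls = x := by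
  obtain ⟨γ, rfl⟩ := Quotient.exists_rep x
  obtain ⟨i, j, h⟩ := exists_hasWinding γ
  exact ⟨i, j, h.freeClass_eq.symm⟩

/-- A smooth loop in the class `aⁱbʲ` has a lift that moves by `(i, j)` in a period. -/
theorem SmoothLoop.lift_add_one_of_cls_eq {α : SmoothLoop} {i j : ℤ}
    (h : α.cls = (windingLoop i j).cls) (s : ℝ) :
    α.lift (s + 1) = α.lift s + ((i : ℝ), (j : ℝ)) := by
  obtain ⟨k, l, hkl⟩ := exists_hasWinding_of_lift (γ := α.toLoop) α.contDiff_lift.continuous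
    fun _ => rfl
  obtain ⟨rfl, rfl⟩ := (SmoothLoop.hasWinding_toLoop hkl).eq_of_homotopic
    (hasWinding_windingLoop i j) (Quotient.exact h)
  exact hkl s

theorem hasWinding_pathLoop {x : Torus} (γ : Path x x) {f : ℝ → ℝ × ℝ} (hf : Continuous f)
    (hγ : ∀ u ∈ Set.Icc (0 : ℝ) 1, torusProj (f u) = γ.extend u) {i j : ℤ}
    (h : f 1 = f 0 + ((i : ℝ), (j : ℝ))) : HasWinding (pathLoop γ) i j := by
  obtain ⟨k, l, g, hg, hgγ, hp⟩ := exists_hasWinding (pathLoop γ)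
  have hloop : ∀ u ∈ Set.Icc (0 : ℝ) 1, pathLoop γ (u : UnitAddCircle) = γ.extend u := by
    rintro u ⟨h0, h1⟩
    rcases h1.lt_or_eq with h1 | rfl
    · exact AddCircle.liftIco_coe_apply (f := γ.extend) ⟨h0, by rwa [zero_add]⟩
    -- `AddCircle.liftIco` reads values only on `[0, 1)`; at the endpoint 1 the path must be
    -- compared with its value at 0.
    · have : ((1 : ℝ) : UnitAddCircle) = ((0 : ℝ) : UnitAddCircle) :=
        AddCircle.coe_period (1 : ℝ)
      rw [this]
      refine (AddCircle.liftIco_coe_apply (f := γ.extend) ⟨le_rfl, by norm_num⟩).trans ?_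
      simp
  obtain ⟨m, n, hmn⟩ := torus_lift_unique (X := unitInterval) (F := fun u => f u)
    (G := fun u => g u) (by fun_prop) (by fun_prop)
    (fun u => by rw [hγ u u.2, hgγ, hloop u u.2])
  have h0 := hmn 0
  have h1 := hmn 1
  have h2 := hp 0
  simp only [Set.Icc.coe_zero, Set.Icc.coe_one, zero_add] at h0 h1 h2
  rw [h, h0, h2] at h1
  simp only [Prod.ext_iff, Prod.fst_add, Prod.snd_add] at h1
  have hi : (i : ℝ) = k := by linarith [h1.1]
  have hj : (j : ℝ) = l := by linarith [h1.2]
  have hi' : i = k := by exact_mod_cast hi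
  have hj' : j = l := by exact_mod_cast hj
  subst hi' hj'
  exact ⟨g, hg, hgγ, hp⟩

theorem SmoothLoop.hasWinding_productAt {α β : SmoothLoop} {i j k l : ℤ}
    (hα : ∀ s, α.lift (s + 1) = α.lift s + ((i : ℝ), (j : ℝ)))
    (hβ : ∀ s, β.lift (s + 1) = β.lift s + ((k : ℝ), (l : ℝ)))
    (p : SmoothLoop.crossings α β) :
    HasWinding (SmoothLoop.productAt α β p) (i + k) (j + l) := by
  have hαc := α.contDiff_lift.continuous
  have hβc := β.contDiff_lift.continuous
  obtain ⟨⟨s, t⟩, hs, ht, hst⟩ := p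
  simp only at hst
  have hshift : torusProj (α.lift (s + 1) - β.lift t) = 0 := by
    rw [torusProj_sub, sub_eq_zero]
    exact (α.periodic s).trans hst
  -- The lift of `β` is translated by an integer vector so that it starts where the lift of `α`
  -- ends.
  refine hasWinding_pathLoop _ (f := fun u => if u ≤ 1 / 2 then α.lift (s + 2 * u)
    else β.lift (t + (2 * u - 1)) + (α.lift (s + 1) - β.lift t)) ?_ ?_ ?_
  · refine Continuous.if_le (by fun_prop) (by fun_prop) continuous_id continuous_const ?_
    rintro u rfl
    norm_num
  · intro u hu
    rw [Path.extend_apply _ hu, Path.trans_apply]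
    simp only
    split_ifs with h
    · rfl
    · rw [torusProj_add, hshift, add_zero]
      rfl
  · norm_num [hα, hβ]
    ext <;> simp <;> ring

/-! ### Existence of transverse representatives -/

/-- The loop `t ↦ v + (k t, l t)`. -/
def translatedLoop (v : ℝ × ℝ) (k l : ℤ) : SmoothLoop where
  lift s := v + (k * s, l * s)
  contDiff_lift := by fun_prop
  periodic s := by
    simp [torusProj, mul_add]

theorem translatedLoop_cls (v : ℝ × ℝ) (k l : ℤ) :
    (translatedLoop v k l).cls = (windingLoop k l).cls := by
  refine (SmoothLoop.hasWinding_toLoop fun s => ?_).freeClass_eq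
  simp [translatedLoop, mul_add, add_assoc]

theorem SmoothLoop.curve_eq_curve_iff {α β : SmoothLoop} {s t : ℝ} :
    α.curve s = β.curve t ↔ ∃ m n : ℤ, α.lift s - β.lift t = ((m : ℝ), (n : ℝ)) := by
  rw [← torusProj_eq_zero_iff, torusProj_sub, sub_eq_zero]
  rfl

theorem deriv_windingLoop_lift (i j : ℤ) (s : ℝ) :
    deriv (windingLoop i j).lift s = ((i : ℝ), (j : ℝ)) := by
  have h : ∀ k : ℤ, HasDerivAt (fun s : ℝ => (k : ℝ) * s) (k : ℝ) s := fun k => by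
    simpa using (hasDerivAt_id s).const_mul (k : ℝ)
  exact ((h i).prodMk (h j)).deriv

theorem windingLoop_transverse {i j k l : ℤ} (h : i * l - j * k ≠ 0) :
    (windingLoop i j).Transverse (windingLoop k l) := by
  have hd : (i : ℝ) * l - j * k ≠ 0 := by exact_mod_cast h
  refine ⟨?_, fun p _ => ?_⟩
  -- Crossing parameters solve a linear system with a bounded integer right-hand side `(m, n)`; the
  -- map is Cramer's rule.
  · refine Set.Finite.subset (((Set.finite_Icc (-(|i| + |k|)) (|i| + |k|)).prod
      (Set.finite_Icc (-(|j| + |l|)) (|j| + |l|))).image fun q : ℤ × ℤ =>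
        (((q.1 : ℝ) * l - k * q.2) / (i * l - j * k), ((q.1 : ℝ) * j - i * q.2) / (i * l - j * k)))
      ?_
    rintro ⟨s, t⟩ ⟨hs, ht, hst⟩
    obtain ⟨m, n, hmn⟩ := SmoothLoop.curve_eq_curve_iff.1 hst
    simp only [windingLoop, Prod.ext_iff, Prod.fst_sub, Prod.snd_sub] at hmn hs ht
    have bound : ∀ a c r : ℤ, (a : ℝ) * s - c * t = r → r ∈ Set.Icc (-(|a| + |c|)) (|a| + |c|) := by
      intro a c r hr
      rw [Set.mem_Icc, ← abs_le]
      have h1 : |(a : ℝ) * s| ≤ |(a : ℝ)| := by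
        rw [abs_mul]
        exact mul_le_of_le_one_right (abs_nonneg _) (abs_le.2 ⟨by linarith [hs.1], hs.2.le⟩)
      have h2 : |(c : ℝ) * t| ≤ |(c : ℝ)| := by
        rw [abs_mul]
        exact mul_le_of_le_one_right (abs_nonneg _) (abs_le.2 ⟨by linarith [ht.1], ht.2.le⟩)
      have h3 : |(r : ℝ)| ≤ |(a : ℝ)| + |(c : ℝ)| := by
        rw [← hr]
        exact (abs_sub _ _).trans (add_le_add h1 h2)
      exact_mod_cast h3
    refine ⟨(m, n), ⟨bound i k m hmn.1, bound j l n hmn.2⟩, ?_⟩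
    simp only [← hmn.1, ← hmn.2]
    ext
    · simp only
      rw [div_eq_iff hd]
      ring
    · simp only
      rw [div_eq_iff hd]
      ring
  · rw [SmoothLoop.velocityDet, deriv_windingLoop_lift, deriv_windingLoop_lift]
    exact hd

theorem exists_parallel_direction {i j k l : ℤ} (h : i * l - j * k = 0) :
    ∃ u v : ℤ, (u ≠ 0 ∨ v ≠ 0) ∧ u * j = v * i ∧ u * l = v * k := by
  by_cases h1 : i = 0 ∧ j = 0
  · by_cases h2 : k = 0 ∧ l = 0
    · exact ⟨1, 0, by simp, by simp [h1], by simp [h2]⟩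
    · exact ⟨k, l, by tauto, by simp [h1], mul_comm _ _⟩
  · exact ⟨i, j, by tauto, mul_comm _ _, by linarith⟩

/-- The integral linear form `(x, y) ↦ u * y - w * x` kills both directions. It is an integer on
deck translations, so offsetting one loop by half a unit in this form leaves no crossing. -/
theorem exists_disjoint_translatedLoop {i j k l : ℤ} (h : i * l - j * k = 0) :
    ∃ v : ℝ × ℝ, SmoothLoop.crossings (windingLoop i j) (translatedLoop v k l) = ∅ := by
  obtain ⟨u, w, hne, h1, h2⟩ := exists_parallel_direction h
  have hpos : (0 : ℝ) < (u : ℝ) ^ 2 + (w : ℝ) ^ 2 := by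
    rcases hne with hne | hne
    · have : (u : ℝ) ≠ 0 := by exact_mod_cast hne
      positivity
    · have : (w : ℝ) ≠ 0 := by exact_mod_cast hne
      positivity
  have h1' : (u : ℝ) * j = w * i := by exact_mod_cast h1
  have h2' : (u : ℝ) * l = w * k := by exact_mod_cast h2
  refine ⟨(w / (2 * ((u : ℝ) ^ 2 + (w : ℝ) ^ 2)), -u / (2 * ((u : ℝ) ^ 2 + (w : ℝ) ^ 2))), ?_⟩
  refine Set.eq_empty_of_forall_notMem ?_
  rintro ⟨s, t⟩ ⟨-, -, hst⟩
  obtain ⟨m, n, hmn⟩ := SmoothLoop.curve_eq_curve_iff.1 hst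
  simp only [windingLoop, translatedLoop, Prod.ext_iff, Prod.fst_sub, Prod.snd_sub,
    Prod.fst_add, Prod.snd_add] at hmn
  have hval : (u : ℝ) * n - w * m = 1 / 2 := by
    rw [← hmn.1, ← hmn.2]
    field_simp
    linear_combination (2 * s * (u ^ 2 + w ^ 2) : ℝ) * h1' - (2 * t * (u ^ 2 + w ^ 2) : ℝ) * h2'
  have hval' : 2 * (u * n - w * m) = 1 := by
    have : (2 : ℝ) * (u * n - w * m) = 1 := by linarith
    exact_mod_cast this
  omega

theorem exists_represents (x y : FreeLoopClass Torus) :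
    ∃ α β : SmoothLoop, Represents α β x y := by
  obtain ⟨i, j, rfl⟩ := exists_windingLoop_cls_eq x
  obtain ⟨k, l, rfl⟩ := exists_windingLoop_cls_eq y
  by_cases h : i * l - j * k = 0
  · obtain ⟨v, hv⟩ := exists_disjoint_translatedLoop h
    exact ⟨windingLoop i j, translatedLoop v k l, ⟨by simp [hv], by simp [hv]⟩, rfl,
      translatedLoop_cls v k l⟩
  · exact ⟨_, _, windingLoop_transverse h, rfl, rfl⟩

/-! ### Integration against the area form -/

/-- A half-open unit square in the plane. -/
def unitBox (a b : ℝ) : Set (ℝ × ℝ) := Set.Ioc a (a + 1) ×ˢ Set.Ioc b (b + 1)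

/-- The universal covering of the torus, with the torus as a space of functions. -/
def addTorusProj (v : ℝ × ℝ) : UnitAddTorus (Fin 2) :=
  ![(v.1 : UnitAddCircle), (v.2 : UnitAddCircle)]

theorem continuous_addTorusProj : Continuous addTorusProj := by
  refine continuous_pi fun i => ?_
  fin_cases i
  · exact (AddCircle.continuous_mk' 1).comp continuous_fst
  · exact (AddCircle.continuous_mk' 1).comp continuous_snd

theorem mFourier_addTorusProj (n : Fin 2 → ℤ) (v : ℝ × ℝ) :
    UnitAddTorus.mFourier n (addTorusProj v) =
      Complex.exp (2 * Real.pi * Complex.I * (n 0 * v.1 + n 1 * v.2)) := by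
  simp only [UnitAddTorus.mFourier, ContinuousMap.coe_mk, addTorusProj, Fin.prod_univ_two,
    Matrix.cons_val_zero, Matrix.cons_val_one, fourier_coe_apply, ← Complex.exp_add]
  congr 1
  push_cast
  ring

/-- The cross product of two plane vectors. -/
def cross (v w : ℝ × ℝ) : ℝ := v.1 * w.2 - v.2 * w.1

theorem hasDerivAt_fst_ofReal {A : ℝ → ℝ × ℝ} (hA : ContDiff ℝ ∞ A) (s : ℝ) :
    HasDerivAt (fun s => ((A s).1 : ℂ)) ((deriv A s).1 : ℂ) s := by
  have h := hasFDerivAt_fst.comp_hasDerivAt s (hA.differentiable (by simp) s).hasDerivAt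
  exact h.ofReal_comp

theorem hasDerivAt_snd_ofReal {A : ℝ → ℝ × ℝ} (hA : ContDiff ℝ ∞ A) (s : ℝ) :
    HasDerivAt (fun s => ((A s).2 : ℂ)) ((deriv A s).2 : ℂ) s := by
  have h := hasFDerivAt_snd.comp_hasDerivAt s (hA.differentiable (by simp) s).hasDerivAt
  exact h.ofReal_comp

/-- Up to the factor `2πi`, the integrand is the derivative of a character along `A`, which is
periodic because the winding is integral. -/
theorem integral_exp_mul_deriv {A : ℝ → ℝ × ℝ} (hA : ContDiff ℝ ∞ A) {i j : ℤ}
    (hp : ∀ s, A (s + 1) = A s + ((i : ℝ), (j : ℝ))) (m n : ℤ) (a : ℝ) :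
    (m : ℂ) * (∫ s in Set.Ioc a (a + 1), Complex.exp (2 * Real.pi * Complex.I *
        (m * (A s).1 + n * (A s).2)) * ((deriv A s).1 : ℂ)) +
      n * (∫ s in Set.Ioc a (a + 1), Complex.exp (2 * Real.pi * Complex.I *
        (m * (A s).1 + n * (A s).2)) * ((deriv A s).2 : ℂ)) = 0 := by
  have hc : Continuous A := hA.continuous
  have hd : Continuous (deriv A) := hA.continuous_deriv (by simp)
  set f : ℝ → ℂ := fun s => Complex.exp (2 * Real.pi * Complex.I * (m * (A s).1 + n * (A s).2))
    with hf
  have hfc : Continuous f := by fun_prop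
  have hfd : ∀ s, HasDerivAt f (f s * (2 * Real.pi * Complex.I *
      (m * ((deriv A s).1 : ℂ) + n * ((deriv A s).2 : ℂ)))) s := fun s =>
    ((((hasDerivAt_fst_ofReal hA s).const_mul (m : ℂ)).add
      ((hasDerivAt_snd_ofReal hA s).const_mul (n : ℂ))).const_mul _).cexp
  have hper : f (a + 1) = f a := by
    simp only [hf, hp, Prod.fst_add, Prod.snd_add]
    rw [Complex.exp_eq_exp_iff_exists_int]
    exact ⟨m * i + n * j, by push_cast; ring⟩
  have hint := intervalIntegral.integral_eq_sub_of_hasDerivAt (a := a) (b := a + 1)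
    (fun s _ => hfd s) (Continuous.intervalIntegrable (by fun_prop) _ _)
  rw [hper, sub_self] at hint
  have hI : ∀ g : ℝ → ℂ, ∫ s in Set.Ioc a (a + 1), g s = ∫ s in a..a + 1, g s := fun g =>
    (intervalIntegral.integral_of_le (by linarith)).symm
  have hpi : (2 * Real.pi * Complex.I : ℂ) ≠ 0 := by simp [Real.pi_ne_zero]
  rw [hI, hI, ← intervalIntegral.integral_const_mul, ← intervalIntegral.integral_const_mul,
    ← intervalIntegral.integral_add (Continuous.intervalIntegrable (by fun_prop) _ _)
      (Continuous.intervalIntegrable (by fun_prop) _ _)]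
  refine (mul_eq_zero.1 ?_).resolve_left hpi
  rw [← intervalIntegral.integral_const_mul, ← hint]
  congr 1
  ext s
  ring

theorem integral_deriv_period {A : ℝ → ℝ × ℝ} (hA : ContDiff ℝ ∞ A) {i j : ℤ}
    (hp : ∀ s, A (s + 1) = A s + ((i : ℝ), (j : ℝ))) (a : ℝ) :
    (∫ s in Set.Ioc a (a + 1), ((deriv A s).1 : ℂ)) = i ∧
      (∫ s in Set.Ioc a (a + 1), ((deriv A s).2 : ℂ)) = j := by
  have hd : Continuous (deriv A) := hA.continuous_deriv (by simp)
  rw [← intervalIntegral.integral_of_le (by linarith),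
    ← intervalIntegral.integral_of_le (by linarith)]
  constructor
  · rw [intervalIntegral.integral_eq_sub_of_hasDerivAt (fun s _ => hasDerivAt_fst_ofReal hA s)
      (Continuous.intervalIntegrable (by fun_prop) _ _), hp]
    simp
  · rw [intervalIntegral.integral_eq_sub_of_hasDerivAt (fun s _ => hasDerivAt_snd_ofReal hA s)
      (Continuous.intervalIntegrable (by fun_prop) _ _), hp]
    simp

/-- A character of `A s - B t` factors into a function of `s` and one of `t`, so the integral is the
cross product of two vectors of line integrals. For `n = 0` these are the winding vectors; for `n ≠
0` both are annihilated by `n`, hence parallel. -/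
theorem integral_mFourier_mul_cross {A B : ℝ → ℝ × ℝ} (hA : ContDiff ℝ ∞ A)
    (hB : ContDiff ℝ ∞ B) {i j k l : ℤ} (hpA : ∀ s, A (s + 1) = A s + ((i : ℝ), (j : ℝ)))
    (hpB : ∀ s, B (s + 1) = B s + ((k : ℝ), (l : ℝ))) (a b : ℝ) (n : Fin 2 → ℤ) :
    ∫ x in unitBox a b, UnitAddTorus.mFourier n (addTorusProj (A x.1 - B x.2)) *
      (cross (deriv A x.1) (deriv B x.2) : ℂ) = if n = 0 then (i * l - j * k : ℂ) else 0 := by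
  have hcA : Continuous A := hA.continuous
  have hdA : Continuous (deriv A) := hA.continuous_deriv (by simp)
  have hcB : Continuous B := hB.continuous
  have hdB : Continuous (deriv B) := hB.continuous_deriv (by simp)
  set f : ℝ → ℂ := fun s =>
    Complex.exp (2 * Real.pi * Complex.I * (n 0 * (A s).1 + n 1 * (A s).2)) with hf
  set g : ℝ → ℂ := fun s => Complex.exp (2 * Real.pi * Complex.I *
    ((-n 0 : ℤ) * (B s).1 + (-n 1 : ℤ) * (B s).2)) with hg
  have hfc : Continuous f := by fun_prop
  have hgc : Continuous g := by fun_prop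
  have hsplit : ∀ x : ℝ × ℝ, UnitAddTorus.mFourier n (addTorusProj (A x.1 - B x.2)) *
      (cross (deriv A x.1) (deriv B x.2) : ℂ) =
      (f x.1 * ((deriv A x.1).1 : ℂ)) * (g x.2 * ((deriv B x.2).2 : ℂ)) -
        (f x.1 * ((deriv A x.1).2 : ℂ)) * (g x.2 * ((deriv B x.2).1 : ℂ)) := by
    intro x
    have : UnitAddTorus.mFourier n (addTorusProj (A x.1 - B x.2)) = f x.1 * g x.2 := by
      rw [mFourier_addTorusProj, hf, hg]
      simp only [← Complex.exp_add]
      congr 1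
      push_cast [Prod.fst_sub, Prod.snd_sub]
      ring
    rw [this, cross]
    push_cast
    ring
  have hI : ∀ h : ℝ × ℝ → ℂ, Continuous h → IntegrableOn h (unitBox a b) := fun h hh =>
    (hh.continuousOn.integrableOn_compact (isCompact_Icc.prod isCompact_Icc)).mono_set
      (Set.prod_mono Set.Ioc_subset_Icc_self Set.Ioc_subset_Icc_self)
  simp_rw [hsplit]
  rw [integral_sub (hI _ (by fun_prop)) (hI _ (by fun_prop)), unitBox, Measure.volume_eq_prod,
    setIntegral_prod_mul (fun s => f s * ((deriv A s).1 : ℂ)) (fun t => g t * ((deriv B t).2 : ℂ)),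
    setIntegral_prod_mul (fun s => f s * ((deriv A s).2 : ℂ)) (fun t => g t * ((deriv B t).1 : ℂ))]
  split_ifs with hn
  · subst hn
    obtain ⟨h1, h2⟩ := integral_deriv_period hA hpA a
    obtain ⟨h3, h4⟩ := integral_deriv_period hB hpB b
    simp [hf, hg, h1, h2, h3, h4]
  · have h1 := integral_exp_mul_deriv hA hpA (n 0) (n 1) a
    have h2 := integral_exp_mul_deriv hB hpB (-n 0) (-n 1) b
    change (n 0 : ℂ) * (∫ s in Set.Ioc a (a + 1), f s * ((deriv A s).1 : ℂ)) +
      n 1 * (∫ s in Set.Ioc a (a + 1), f s * ((deriv A s).2 : ℂ)) = 0 at h1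
    change ((-n 0 : ℤ) : ℂ) * (∫ s in Set.Ioc b (b + 1), g s * ((deriv B s).1 : ℂ)) +
      (-n 1 : ℤ) * (∫ s in Set.Ioc b (b + 1), g s * ((deriv B s).2 : ℂ)) = 0 at h2
    push_cast at h2
    by_cases h0 : n 0 = 0
    · have h0' : (n 1 : ℂ) ≠ 0 := by
        intro h
        exact hn (funext fun i => by fin_cases i; exacts [h0, by exact_mod_cast h])
      refine (mul_eq_zero.1 ?_).resolve_left h0'
      linear_combination -(∫ s in Set.Ioc a (a + 1), f s * ((deriv A s).1 : ℂ)) * h2 -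
        (∫ s in Set.Ioc b (b + 1), g s * ((deriv B s).1 : ℂ)) * h1
    · have h0' : (n 0 : ℂ) ≠ 0 := by exact_mod_cast h0
      refine (mul_eq_zero.1 ?_).resolve_left h0'
      linear_combination (∫ s in Set.Ioc b (b + 1), g s * ((deriv B s).2 : ℂ)) * h1 +
        (∫ s in Set.Ioc a (a + 1), f s * ((deriv A s).2 : ℂ)) * h2

/-- Integration of functions on the torus against the pullback of the area form by
`(s, t) ↦ A s - B t`. -/
def crossFunctional {A B : ℝ → ℝ × ℝ} (hA : ContDiff ℝ ∞ A) (hB : ContDiff ℝ ∞ B) (a b : ℝ) :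
    C(UnitAddTorus (Fin 2), ℂ) →L[ℂ] ℂ :=
  have hcA : Continuous A := hA.continuous
  have hdA : Continuous (deriv A) := hA.continuous_deriv (by simp)
  have hcB : Continuous B := hB.continuous
  have hdB : Continuous (deriv B) := hB.continuous_deriv (by simp)
  have hI : ∀ h : ℝ × ℝ → ℂ, Continuous h → IntegrableOn h (unitBox a b) := fun h hh =>
    (hh.continuousOn.integrableOn_compact (isCompact_Icc.prod isCompact_Icc)).mono_set
      (Set.prod_mono Set.Ioc_subset_Icc_self Set.Ioc_subset_Icc_self)
  have hD : Continuous fun x : ℝ × ℝ => (cross (deriv A x.1) (deriv B x.2) : ℂ) := by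
    unfold cross
    fun_prop
  have hρ : ∀ ρ : C(UnitAddTorus (Fin 2), ℂ), Continuous fun x : ℝ × ℝ =>
      ρ (addTorusProj (A x.1 - B x.2)) * (cross (deriv A x.1) (deriv B x.2) : ℂ) := fun ρ =>
    (ρ.continuous.comp (continuous_addTorusProj.comp (by fun_prop))).mul hD
  LinearMap.mkContinuousOfExistsBound
    { toFun := fun ρ => ∫ x in unitBox a b, ρ (addTorusProj (A x.1 - B x.2)) *
        (cross (deriv A x.1) (deriv B x.2) : ℂ)
      map_add' := fun ρ σ => by
        rw [← integral_add (hI _ (hρ ρ)) (hI _ (hρ σ))]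
        simp [add_mul]
      map_smul' := fun c ρ => by
        simp [mul_assoc, integral_const_mul] }
    ⟨∫ x in unitBox a b, ‖(cross (deriv A x.1) (deriv B x.2) : ℂ)‖, fun ρ => by
      rw [mul_comm, ← integral_const_mul]
      refine norm_integral_le_of_norm_le ((hI _ hD).norm.const_mul _)
        (Filter.Eventually.of_forall fun x => ?_)
      rw [norm_mul]
      exact mul_le_mul_of_nonneg_right (ρ.norm_coe_le_norm _) (norm_nonneg _)⟩

theorem crossFunctional_apply {A B : ℝ → ℝ × ℝ} (hA : ContDiff ℝ ∞ A) (hB : ContDiff ℝ ∞ B)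
    (a b : ℝ) (ρ : C(UnitAddTorus (Fin 2), ℂ)) :
    crossFunctional hA hB a b ρ = ∫ x in unitBox a b, ρ (addTorusProj (A x.1 - B x.2)) *
      (cross (deriv A x.1) (deriv B x.2) : ℂ) := rfl

/-- The degree of `(s, t) ↦ A s - B t` as a map of tori, computed by integration. -/
theorem integral_mul_cross_eq {A B : ℝ → ℝ × ℝ} (hA : ContDiff ℝ ∞ A)
    (hB : ContDiff ℝ ∞ B) {i j k l : ℤ} (hpA : ∀ s, A (s + 1) = A s + ((i : ℝ), (j : ℝ)))
    (hpB : ∀ s, B (s + 1) = B s + ((k : ℝ), (l : ℝ))) (a b a' b' : ℝ)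
    {ρ : Torus → ℝ} (hρ : Continuous ρ) :
    ∫ x in unitBox a b, ρ (torusProj (A x.1 - B x.2)) * cross (deriv A x.1) (deriv B x.2) =
      (i * l - j * k : ℤ) * ∫ x in unitBox a' b', ρ (torusProj x) := by
  -- The reference pair satisfies `A₀ s - B₀ t = (s, t)` with cross product `-1`, so minus its
  -- functional is plain integration over the torus.
  have hA₀ : ContDiff ℝ ∞ fun s : ℝ => (s, (0 : ℝ)) := by fun_prop
  have hB₀ : ContDiff ℝ ∞ fun s : ℝ => ((0 : ℝ), -s) := by fun_prop
  have hp₀ : ∀ s : ℝ, (s + 1, (0 : ℝ)) = (s, 0) + (((1 : ℤ) : ℝ), ((0 : ℤ) : ℝ)) := by simp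
  have hq₀ : ∀ s : ℝ, ((0 : ℝ), -(s + 1)) = (0, -s) + (((0 : ℤ) : ℝ), ((-1 : ℤ) : ℝ)) := by
    intro s
    simp
    ring
  have hcross : ∀ s t : ℝ,
      cross (deriv (fun s : ℝ => (s, (0 : ℝ))) s) (deriv (fun s : ℝ => ((0 : ℝ), -s)) t) = -1 := by
    intro s t
    rw [((hasDerivAt_id' s).prodMk (hasDerivAt_const s (0 : ℝ))).deriv,
      ((hasDerivAt_const t (0 : ℝ)).prodMk (hasDerivAt_neg' t)).deriv]
    simp [cross]
  have key : crossFunctional hA hB a b =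
      (-(i * l - j * k : ℤ) : ℂ) • crossFunctional hA₀ hB₀ a' b' := by
    refine ContinuousLinearMap.ext_on (s := Set.range UnitAddTorus.mFourier) ?_ ?_
    · rw [dense_iff_closure_eq, ← Submodule.topologicalClosure_coe,
        UnitAddTorus.span_mFourier_closure_eq_top]
      rfl
    · rintro _ ⟨n, rfl⟩
      rw [_root_.smul_apply, crossFunctional_apply, crossFunctional_apply,
        integral_mFourier_mul_cross hA hB hpA hpB,
        integral_mFourier_mul_cross hA₀ hB₀ hp₀ hq₀]
      split_ifs <;> simp
  have h := congrArg (fun Φ => Φ ⟨fun x => (ρ (x 0, x 1) : ℂ), by fun_prop⟩) key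
  simp only [_root_.smul_apply, crossFunctional_apply, ContinuousMap.coe_mk,
    hcross] at h
  have h' : ((∫ x in unitBox a b, ρ (torusProj (A x.1 - B x.2)) *
      cross (deriv A x.1) (deriv B x.2) : ℝ) : ℂ) =
      (((i * l - j * k : ℤ) * ∫ x in unitBox a' b', ρ (torusProj x) : ℝ) : ℂ) := by
    rw [← integral_complex_ofReal, Complex.ofReal_mul, ← integral_complex_ofReal]
    push_cast
    refine h.trans ?_
    simp [addTorusProj, torusProj, integral_neg]
    ring
  exact_mod_cast h'

/-! ### Localization at the intersections -/

theorem measurableSet_unitBox (a b : ℝ) : MeasurableSet (unitBox a b) :=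
  measurableSet_Ioc.prod measurableSet_Ioc

theorem integrableOn_unitBox {f : ℝ × ℝ → ℝ} (hf : Continuous f) (a b : ℝ) :
    IntegrableOn f (unitBox a b) :=
  (hf.continuousOn.integrableOn_compact (isCompact_Icc.prod isCompact_Icc)).mono_set
    (Set.prod_mono Set.Ioc_subset_Icc_self Set.Ioc_subset_Icc_self)

theorem norm_torusProj_eq {v : ℝ × ℝ} (hv : ‖v‖ ≤ 1 / 2) : ‖torusProj v‖ = ‖v‖ := by
  rw [Prod.norm_def, Prod.norm_def]
  rw [Prod.norm_def, sup_le_iff] at hv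
  have h : ∀ x : ℝ, ‖x‖ ≤ 1 / 2 → ‖(x : UnitAddCircle)‖ = ‖x‖ := fun x hx =>
    (AddCircle.norm_coe_eq_abs_iff 1 one_ne_zero).2 (by simpa using hx)
  exact congrArg₂ max (h _ hv.1) (h _ hv.2)

/-- A tent function of radius `ε` at the origin. -/
def tent {E : Type*} [SeminormedAddCommGroup E] (ε : ℝ) (v : E) : ℝ := max 0 (ε - ‖v‖)

theorem continuous_tent {E : Type*} [SeminormedAddCommGroup E] (ε : ℝ) :
    Continuous (tent ε : E → ℝ) := by
  unfold tent
  fun_prop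

theorem tent_eq_zero {E : Type*} [SeminormedAddCommGroup E] {ε : ℝ} {v : E} (h : ε ≤ ‖v‖) :
    tent ε v = 0 := max_eq_left (by linarith)

theorem tent_torusProj {ε : ℝ} {v : ℝ × ℝ} (hv : ‖v‖ ≤ 1 / 2) :
    tent ε (torusProj v) = tent ε v := by
  rw [tent, norm_torusProj_eq hv, tent]

theorem integral_tent_pos {ε : ℝ} (hε : 0 < ε) : 0 < ∫ v : ℝ × ℝ, tent ε v := by
  refine (continuous_tent ε).integral_pos_of_hasCompactSupport_nonneg_nonzero
    (x := (0 : ℝ × ℝ)) ?_ (fun v => le_max_left _ _) ?_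
  · refine HasCompactSupport.intro (isCompact_closedBall (0 : ℝ × ℝ) ε) fun v hv => ?_
    rw [Metric.mem_closedBall, dist_zero_right, not_le] at hv
    exact tent_eq_zero hv.le
  · simp [tent, hε.ne', hε.le]

theorem setIntegral_unitBox_tent {ε : ℝ} (hε : ε ≤ 1 / 2) :
    ∫ v in unitBox (-1 / 2) (-1 / 2), tent ε (torusProj v) = ∫ v : ℝ × ℝ, tent ε v := by
  have h1 : ∀ v ∈ unitBox (-1 / 2) (-1 / 2), tent ε (torusProj v) = tent ε v := by
    rintro ⟨x, y⟩ ⟨hx, hy⟩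
    refine tent_torusProj ?_
    rw [Prod.norm_def, sup_le_iff]
    simp only [Real.norm_eq_abs, abs_le]
    simp only [Set.mem_Ioc] at hx hy
    exact ⟨⟨by linarith, by linarith⟩, by linarith, by linarith⟩
  rw [setIntegral_congr_fun (measurableSet_unitBox _ _) h1]
  refine setIntegral_eq_integral_of_forall_compl_eq_zero ?_
  rintro ⟨x, y⟩ hxy
  refine tent_eq_zero (hε.trans ?_)
  by_contra! hlt
  rw [Prod.norm_def, sup_lt_iff] at hlt
  simp only [Real.norm_eq_abs, abs_lt] at hlt
  refine hxy ⟨⟨?_, ?_⟩, ?_, ?_⟩ <;> simp only <;> linarith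

/-- Near a nondegenerate zero, a map of the plane is injective with derivative of constant sign. -/
theorem exists_local_chart {F : ℝ × ℝ → ℝ × ℝ} (hF : ContDiff ℝ ∞ F) {p : ℝ × ℝ}
    (hp : (fderiv ℝ F p).det ≠ 0) {W : Set (ℝ × ℝ)} (hW : W ∈ 𝓝 p) :
    ∃ U : Set (ℝ × ℝ), IsOpen U ∧ p ∈ U ∧ U ⊆ W ∧ Set.InjOn F U ∧ F '' U ∈ 𝓝 (F p) ∧
      (∀ x ∈ U, ‖F x - F p‖ < 1 / 2) ∧
      ∀ x ∈ U, (fderiv ℝ F x).det =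
        (SignType.sign (fderiv ℝ F p).det : ℝ) * |(fderiv ℝ F x).det| := by
  let e := (fderiv ℝ F p).toContinuousLinearEquivOfDetNeZero hp
  have hs : HasStrictFDerivAt F (e : ℝ × ℝ →L[ℝ] ℝ × ℝ) p :=
    hF.contDiffAt.hasStrictFDerivAt (by simp)
  have hdet : Continuous fun x => (fderiv ℝ F x).det :=
    ContinuousLinearMap.continuous_det.comp (hF.continuous_fderiv (by simp))
  have hsign : ∀ᶠ x in 𝓝 p, (fderiv ℝ F x).det =
      (SignType.sign (fderiv ℝ F p).det : ℝ) * |(fderiv ℝ F x).det| := by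
    rcases hp.lt_or_gt with h | h
    · filter_upwards [hdet.continuousAt.eventually (gt_mem_nhds h)] with x hx
      rw [sign_neg h, abs_of_neg hx]
      simp
    · filter_upwards [hdet.continuousAt.eventually (lt_mem_nhds h)] with x hx
      rw [sign_pos h, abs_of_pos hx]
      simp
  have hball : ∀ᶠ x in 𝓝 p, ‖F x - F p‖ < 1 / 2 := by
    have := hF.continuous.continuousAt (x := p) (Metric.ball_mem_nhds (F p) one_half_pos)
    filter_upwards [this] with x hx
    simpa [dist_eq_norm] using hx
  have hsrc : (hs.toOpenPartialHomeomorph F).source ∈ 𝓝 p :=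
    (hs.toOpenPartialHomeomorph F).open_source.mem_nhds hs.mem_toOpenPartialHomeomorph_source
  obtain ⟨U, hU, hUo, hpU⟩ := mem_nhds_iff.1
    (inter_mem (inter_mem hW hsrc) (inter_mem hball hsign))
  refine ⟨U, hUo, hpU, fun x hx => (hU hx).1.1, ?_, ?_, fun x hx => (hU hx).2.1,
    fun x hx => (hU hx).2.2⟩
  · exact (hs.toOpenPartialHomeomorph F).injOn.mono fun x hx => (hU hx).1.2
  · rw [← hs.map_nhds_eq_of_equiv]
    exact image_mem_map (hUo.mem_nhds hpU)

/-- The integral of a tent function near a nondegenerate zero. -/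
theorem setIntegral_tent_mul_det {F : ℝ × ℝ → ℝ × ℝ} (hF : ContDiff ℝ ∞ F) {p : ℝ × ℝ}
    (hp : torusProj (F p) = 0) {U : Set (ℝ × ℝ)} (hU : IsOpen U) (hinj : Set.InjOn F U)
    (hnear : ∀ x ∈ U, ‖F x - F p‖ < 1 / 2)
    (hsign : ∀ x ∈ U, (fderiv ℝ F x).det =
        (SignType.sign (fderiv ℝ F p).det : ℝ) * |(fderiv ℝ F x).det|)
    {ε : ℝ} (hε : Metric.ball (F p) ε ⊆ F '' U) :
    ∫ x in U, tent ε (torusProj (F x)) * (fderiv ℝ F x).det =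
      (SignType.sign (fderiv ℝ F p).det : ℝ) * ∫ v : ℝ × ℝ, tent ε v := by
  -- Since `F p` is an integer point and `F x` stays within 1/2 of it, the tent can be read in the
  -- plane; the constant sign exposes the Jacobian `|det|` for the change of variables.
  have h1 : ∀ x ∈ U, tent ε (torusProj (F x)) * (fderiv ℝ F x).det =
      (SignType.sign (fderiv ℝ F p).det : ℝ) *
        (|(fderiv ℝ F x).det| • tent ε (F x - F p)) := by
    intro x hx
    rw [← tent_torusProj (hnear x hx).le, torusProj_sub, hp, sub_zero, smul_eq_mul]
    conv_lhs => rw [hsign x hx]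
    ring
  rw [setIntegral_congr_fun hU.measurableSet h1, integral_const_mul,
    ← integral_image_eq_integral_abs_det_fderiv_smul volume hU.measurableSet
      (fun x _ => (hF.differentiable (by simp) x).hasFDerivAt.hasFDerivWithinAt) hinj
      (fun y => tent ε (y - F p)), setIntegral_eq_integral_of_forall_compl_eq_zero,
    integral_sub_right_eq_self (fun v : ℝ × ℝ => tent ε v)]
  intro y hy
  refine tent_eq_zero ?_
  by_contra! hlt
  exact hy (hε (by rwa [Metric.mem_ball, dist_eq_norm]))

/-- The degree of a map of tori localizes at a regular fibre. -/
theorem exists_setIntegral_tent_mul_det {F : ℝ × ℝ → ℝ × ℝ} (hF : ContDiff ℝ ∞ F) {a b : ℝ}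
    (S : Finset (ℝ × ℝ))
    (hS : ∀ x ∈ Set.Icc a (a + 1) ×ˢ Set.Icc b (b + 1), torusProj (F x) = 0 → x ∈ S)
    (hS' : ∀ x ∈ S, torusProj (F x) = 0 ∧ x ∈ Set.Ioo a (a + 1) ×ˢ Set.Ioo b (b + 1) ∧
      (fderiv ℝ F x).det ≠ 0) :
    ∃ ε : ℝ, 0 < ε ∧ ε ≤ 1 / 2 ∧
      ∫ x in unitBox a b, tent ε (torusProj (F x)) * (fderiv ℝ F x).det =
        (∑ p ∈ S, (SignType.sign (fderiv ℝ F p).det : ℝ)) * ∫ v : ℝ × ℝ, tent ε v := by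
  obtain ⟨V, hV, hVd⟩ := S.finite_toSet.t2_separation
  have hchart : ∀ p : ℝ × ℝ, ∃ U : Set (ℝ × ℝ), p ∈ S → (IsOpen U ∧ p ∈ U ∧
      U ⊆ V p ∩ Set.Ioo a (a + 1) ×ˢ Set.Ioo b (b + 1) ∧ Set.InjOn F U ∧ F '' U ∈ 𝓝 (F p) ∧
      (∀ x ∈ U, ‖F x - F p‖ < 1 / 2) ∧ ∀ x ∈ U, (fderiv ℝ F x).det =
        (SignType.sign (fderiv ℝ F p).det : ℝ) * |(fderiv ℝ F x).det|) := by
    intro p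
    by_cases hp : p ∈ S
    · obtain ⟨-, hin, hdet⟩ := hS' p hp
      obtain ⟨U, hU⟩ := exists_local_chart hF hdet (inter_mem ((hV p).2.mem_nhds (hV p).1)
        ((isOpen_Ioo.prod isOpen_Ioo).mem_nhds hin))
      exact ⟨U, fun _ => hU⟩
    · exact ⟨∅, fun h => absurd h hp⟩
  choose U hU using hchart
  -- On the closed box minus the charts, `F` keeps a distance `δ` from the lattice, so a tent of
  -- radius at most `δ` vanishes there.
  have hcompact : IsCompact (Set.Icc a (a + 1) ×ˢ Set.Icc b (b + 1) \ ⋃ p ∈ S, U p) :=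
    (isCompact_Icc.prod isCompact_Icc).diff (isOpen_biUnion fun p hp => (hU p hp).1)
  have hFc : Continuous fun x => ‖torusProj (F x)‖ :=
    (continuous_torusProj.comp hF.continuous).norm
  obtain ⟨δ, hδ, hδ'⟩ := hcompact.exists_forall_le' hFc.continuousOn (a := 0) (by
    rintro x ⟨hx, hxU⟩
    refine norm_pos_iff.2 fun h => hxU ?_
    exact Set.mem_biUnion (hS x hx h) (hU x (hS x hx h)).2.1)
  have hev : ∀ᶠ ε : ℝ in 𝓝[>] 0, 0 < ε ∧ ε ≤ 1 / 2 ∧ ε ≤ δ ∧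
      ∀ p ∈ S, Metric.ball (F p) ε ⊆ F '' U p := by
    refine eventually_mem_nhdsWithin.and
      (((ge_mem_nhds one_half_pos).filter_mono nhdsWithin_le_nhds).and
        (((ge_mem_nhds hδ).filter_mono nhdsWithin_le_nhds).and ?_))
    rw [Finset.eventually_all]
    intro p hp
    obtain ⟨r, hr, hr'⟩ := Metric.mem_nhds_iff.1 (hU p hp).2.2.2.2.1
    filter_upwards [(ge_mem_nhds hr).filter_mono nhdsWithin_le_nhds] with ε hε
    exact (Metric.ball_subset_ball hε).trans hr'
  obtain ⟨ε, hε, hε2, hεδ, hεU⟩ := hev.exists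
  refine ⟨ε, hε, hε2, ?_⟩
  have hsub : ∀ p ∈ S, U p ⊆ unitBox a b := fun p hp x hx =>
    Set.prod_mono Set.Ioo_subset_Ioc_self Set.Ioo_subset_Ioc_self ((hU p hp).2.2.1 hx).2
  have hcont : Continuous fun x => tent ε (torusProj (F x)) * (fderiv ℝ F x).det :=
    ((continuous_tent ε).comp (continuous_torusProj.comp hF.continuous)).mul
      (ContinuousLinearMap.continuous_det.comp (hF.continuous_fderiv (by simp)))
  rw [setIntegral_eq_of_subset_of_forall_sdiff_eq_zero (measurableSet_unitBox a b)
      (Set.iUnion₂_subset hsub) ?_, integral_biUnion_finset, Finset.sum_mul]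
  · refine Finset.sum_congr rfl fun p hp => ?_
    obtain ⟨ho, -, -, hinj, -, hnear, hsign⟩ := hU p hp
    exact setIntegral_tent_mul_det hF (hS' p hp).1 ho hinj hnear hsign (hεU p hp)
  · exact fun p hp => (hU p hp).1.measurableSet
  · intro p hp q hq hpq
    exact (hVd hp hq hpq).mono (fun x hx => ((hU p hp).2.2.1 hx).1)
      (fun x hx => ((hU q hq).2.2.1 hx).1)
  · exact fun p hp => (integrableOn_unitBox hcont a b).mono_set (hsub p hp)
  · rintro x ⟨hx, hxU⟩
    rw [tent_eq_zero, zero_mul]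
    exact hεδ.trans (hδ' x ⟨Set.prod_mono Set.Ioc_subset_Icc_self Set.Ioc_subset_Icc_self hx, hxU⟩)

theorem det_fderiv_sub {A B : ℝ → ℝ × ℝ} (hA : ContDiff ℝ ∞ A) (hB : ContDiff ℝ ∞ B)
    (x : ℝ × ℝ) : (fderiv ℝ (fun x : ℝ × ℝ => A x.1 - B x.2) x).det =
      -cross (deriv A x.1) (deriv B x.2) := by
  have hA' := (hA.differentiable (by simp) x.1).hasFDerivAt.comp x
    (hasFDerivAt_fst (𝕜 := ℝ) (E := ℝ) (F := ℝ))
  have hB' := (hB.differentiable (by simp) x.2).hasFDerivAt.comp x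
    (hasFDerivAt_snd (𝕜 := ℝ) (E := ℝ) (F := ℝ))
  have h : fderiv ℝ (fun x : ℝ × ℝ => A x.1 - B x.2) x =
      (Matrix.toLin (Module.Basis.finTwoProd ℝ) (Module.Basis.finTwoProd ℝ)
        !![(deriv A x.1).1, -(deriv B x.2).1; (deriv A x.1).2, -(deriv B x.2).2]
        ).toContinuousLinearMap := by
    refine (hA'.sub hB').fderiv.trans ?_
    rw [Matrix.toLin_finTwoProd_toContinuousLinearMap]
    ext <;> simp
  rw [h]
  simp only [LinearMap.det_toContinuousLinearMap, LinearMap.det_toLin, Matrix.det_fin_two_of, cross]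
  ring

/-- The tent integral is evaluated globally by degree and locally at the zeros; its positive mass
cancels. The minus sign of `det_fderiv_sub` occurs on both sides. -/
theorem sum_sign_cross_eq {A B : ℝ → ℝ × ℝ} (hA : ContDiff ℝ ∞ A)
    (hB : ContDiff ℝ ∞ B) {i j k l : ℤ} (hpA : ∀ s, A (s + 1) = A s + ((i : ℝ), (j : ℝ)))
    (hpB : ∀ s, B (s + 1) = B s + ((k : ℝ), (l : ℝ))) {a b : ℝ} (S : Finset (ℝ × ℝ))
    (hS : ∀ x ∈ Set.Icc a (a + 1) ×ˢ Set.Icc b (b + 1), torusProj (A x.1 - B x.2) = 0 → x ∈ S)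
    (hS' : ∀ x ∈ S, torusProj (A x.1 - B x.2) = 0 ∧ x ∈ Set.Ioo a (a + 1) ×ˢ Set.Ioo b (b + 1) ∧
      cross (deriv A x.1) (deriv B x.2) ≠ 0) :
    ∑ x ∈ S, (SignType.sign (cross (deriv A x.1) (deriv B x.2)) : ℤ) = i * l - j * k := by
  have hF : ContDiff ℝ ∞ fun x : ℝ × ℝ => A x.1 - B x.2 :=
    (hA.comp contDiff_fst).sub (hB.comp contDiff_snd)
  obtain ⟨ε, hε, hε2, h⟩ := exists_setIntegral_tent_mul_det hF S hS fun x hx => by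
    obtain ⟨h1, h2, h3⟩ := hS' x hx
    exact ⟨h1, h2, by rwa [det_fderiv_sub hA hB, neg_ne_zero]⟩
  have h' := integral_mul_cross_eq hA hB hpA hpB a b (-1 / 2) (-1 / 2) (continuous_tent ε)
  rw [setIntegral_unitBox_tent hε2] at h'
  simp only [det_fderiv_sub hA hB, mul_neg, integral_neg, h', Left.sign_neg] at h
  rw [← neg_mul] at h
  have h2 := mul_right_cancel₀ (integral_tent_pos hε).ne' h
  have h3 : ((i * l - j * k : ℤ) : ℝ) =
      ((∑ x ∈ S, (SignType.sign (cross (deriv A x.1) (deriv B x.2)) : ℤ) : ℤ) : ℝ) := by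
    rw [← neg_inj, h2, Int.cast_sum, ← Finset.sum_neg_distrib]
    refine Finset.sum_congr rfl fun x _ => ?_
    cases SignType.sign (cross (deriv A x.1) (deriv B x.2)) <;> simp
  exact_mod_cast h3.symm

/-! ### The bracket in the basis of winding classes -/

theorem SmoothLoop.deriv_lift_add_int {α : SmoothLoop} {i j : ℤ}
    (h : ∀ s, α.lift (s + 1) = α.lift s + ((i : ℝ), (j : ℝ))) (s : ℝ) (m : ℤ) :
    deriv α.lift (s + m) = deriv α.lift s := by
  have hper : Function.Periodic (deriv α.lift) 1 := fun s => by
    rw [← deriv_comp_add_const]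
    simp [funext h]
  simpa using hper.int_mul m s

theorem SmoothLoop.curve_add_int (α : SmoothLoop) (s : ℝ) (m : ℤ) :
    α.curve (s + m) = α.curve s := by
  simpa using (Function.Periodic.int_mul (f := α.curve) α.periodic m s)

theorem toIcoMod_injOn (a : ℝ) :
    Set.InjOn (toIcoMod (zero_lt_one' ℝ) a) (Set.Ico 0 1) := by
  intro s hs t ht h
  have h1 := toIcoMod_add_toIcoDiv_zsmul (zero_lt_one' ℝ) a s
  have h2 := toIcoMod_add_toIcoDiv_zsmul (zero_lt_one' ℝ) a t
  have h3 : s - t = ((toIcoDiv (zero_lt_one' ℝ) a s - toIcoDiv (zero_lt_one' ℝ) a t : ℤ) : ℝ) := by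
    rw [h] at h1
    push_cast
    simp only [zsmul_eq_mul, mul_one] at h1 h2
    linarith
  have h4 : |s - t| < 1 := by
    rw [abs_lt]
    constructor <;> linarith [hs.1, hs.2, ht.1, ht.2]
  rw [h3, ← Int.cast_abs] at h4
  have h5 : |toIcoDiv (zero_lt_one' ℝ) a s - toIcoDiv (zero_lt_one' ℝ) a t| < 1 := by
    exact_mod_cast h4
  rw [Int.abs_lt_one_iff.1 h5] at h3
  simpa [sub_eq_zero] using h3

/-- The representative `r` is the fractional part of `s`. Both endpoints reduce to `a`, so excluding
`r = a` puts `s` in the interior. -/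
theorem exists_toIcoMod_eq_of_mem_Icc {a s : ℝ} (ha : a ∈ Set.Ico (0 : ℝ) 1)
    (hs : s ∈ Set.Icc a (a + 1)) :
    ∃ r ∈ Set.Ico (0 : ℝ) 1, (∃ m : ℤ, r = s + m) ∧
      (r ≠ a → s ∈ Set.Ioo a (a + 1) ∧ toIcoMod (zero_lt_one' ℝ) a r = s) := by
  refine ⟨Int.fract s, ⟨Int.fract_nonneg s, Int.fract_lt_one s⟩, ⟨-⌊s⌋, ?_⟩, fun hne => ?_⟩
  · rw [← Int.self_sub_floor]
    push_cast
    ring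
  · have hfa : Int.fract a = a := Int.fract_eq_self.2 ⟨ha.1, ha.2⟩
    have h1 : s ≠ a := by
      rintro rfl
      exact hne hfa
    have h2 : s ≠ a + 1 := by
      rintro rfl
      exact hne ((Int.fract_add_one a).trans hfa)
    have h3 : s ∈ Set.Ioo a (a + 1) := ⟨hs.1.lt_of_ne h1.symm, hs.2.lt_of_ne h2⟩
    refine ⟨h3, (toIcoMod_eq_iff _).2 ⟨⟨h3.1.le, h3.2⟩, -⌊s⌋, ?_⟩⟩
    rw [← Int.self_sub_floor]
    simp [sub_eq_add_neg]

theorem SmoothLoop.sum_crossingSign {α β : SmoothLoop} {i j k l : ℤ}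
    (hα : ∀ s, α.lift (s + 1) = α.lift s + ((i : ℝ), (j : ℝ)))
    (hβ : ∀ s, β.lift (s + 1) = β.lift s + ((k : ℝ), (l : ℝ)))
    (h : α.Transverse β) [Fintype (SmoothLoop.crossings α β)] :
    ∑ p : SmoothLoop.crossings α β, SmoothLoop.crossingSign α β p = i * l - j * k := by
  classical
  obtain ⟨hfin, hdet⟩ := h
  -- Localization needs all crossings inside the box, but crossings in `[0, 1)²` may lie on its
  -- edge. The box is moved to a corner `(a, b)` avoiding the finitely many crossing parameters.
  have hex : ∀ T : Set ℝ, T.Finite → ∃ a ∈ Set.Ico (0 : ℝ) 1, a ∉ T := fun T hT =>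
    ((Set.Ico_infinite (zero_lt_one' ℝ)).sdiff hT).nonempty
  obtain ⟨a, ha, haT⟩ := hex _ (hfin.image Prod.fst)
  obtain ⟨b, hb, hbT⟩ := hex _ (hfin.image Prod.snd)
  let r : ℝ × ℝ → ℝ × ℝ := fun p =>
    (toIcoMod (zero_lt_one' ℝ) a p.1, toIcoMod (zero_lt_one' ℝ) b p.2)
  have hr : Set.InjOn r (SmoothLoop.crossings α β) := fun p hp q hq hpq => Prod.ext
    (toIcoMod_injOn a hp.1 hq.1 (congrArg Prod.fst hpq))
    (toIcoMod_injOn b hp.2.1 hq.2.1 (congrArg Prod.snd hpq))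
  have hzero : ∀ x : ℝ × ℝ,
      torusProj (α.lift x.1 - β.lift x.2) = 0 ↔ α.curve x.1 = β.curve x.2 := fun x => by
    rw [torusProj_sub, sub_eq_zero]
    rfl
  have hshift : ∀ p : ℝ × ℝ, ∃ m n : ℤ, r p = (p.1 + m, p.2 + n) := fun p =>
    ⟨-toIcoDiv (zero_lt_one' ℝ) a p.1, -toIcoDiv (zero_lt_one' ℝ) b p.2, by
      simp [r, toIcoMod, sub_eq_add_neg]⟩
  have hcross : ∀ p : ℝ × ℝ, cross (deriv α.lift (r p).1) (deriv β.lift (r p).2) =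
      SmoothLoop.velocityDet α β p.1 p.2 := fun p => by
    obtain ⟨m, n, hmn⟩ := hshift p
    rw [hmn, SmoothLoop.deriv_lift_add_int hα, SmoothLoop.deriv_lift_add_int hβ]
    rfl
  rw [← sum_sign_cross_eq α.contDiff_lift β.contDiff_lift hα hβ (a := a) (b := b)
    (hfin.toFinset.image r), Finset.sum_image (by simpa using hr)]
  · rw [Finset.sum_subtype (p := fun x => x ∈ SmoothLoop.crossings α β) _ (by simp)]
    exact Finset.sum_congr rfl fun p _ => by rw [hcross, SmoothLoop.crossingSign]
  · rintro ⟨s, t⟩ ⟨hs, ht⟩ hst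
    rw [hzero] at hst
    obtain ⟨s', hs', ⟨m, hm⟩, hsa⟩ := exists_toIcoMod_eq_of_mem_Icc ha hs
    obtain ⟨t', ht', ⟨n, hn⟩, htb⟩ := exists_toIcoMod_eq_of_mem_Icc hb ht
    have hmem : (s', t') ∈ SmoothLoop.crossings α β :=
      ⟨hs', ht', by simpa [hm, hn, SmoothLoop.curve_add_int] using hst⟩
    refine Finset.mem_image.2 ⟨(s', t'), by simpa using hmem, Prod.ext ?_ ?_⟩
    · exact (hsa fun h => haT ⟨_, hmem, h⟩).2
    · exact (htb fun h => hbT ⟨_, hmem, h⟩).2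
  · intro x hx
    obtain ⟨p, hp, rfl⟩ := Finset.mem_image.1 hx
    rw [Set.Finite.mem_toFinset] at hp
    obtain ⟨m, n, hmn⟩ := hshift p
    refine ⟨?_, ⟨?_, ?_⟩, ?_⟩
    · rw [hzero, hmn, SmoothLoop.curve_add_int, SmoothLoop.curve_add_int]
      exact hp.2.2
    · have hmem := toIcoMod_mem_Ico (zero_lt_one' ℝ) a p.1
      refine ⟨hmem.1.lt_of_ne fun h => haT ⟨p, hp, ?_⟩, hmem.2⟩
      refine toIcoMod_injOn a hp.1 ha ?_
      rw [← h, toIcoMod_apply_left]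
    · have hmem := toIcoMod_mem_Ico (zero_lt_one' ℝ) b p.2
      refine ⟨hmem.1.lt_of_ne fun h => hbT ⟨p, hp, ?_⟩, hmem.2⟩
      refine toIcoMod_injOn b hp.2.1 hb ?_
      rw [← h, toIcoMod_apply_left]
    · rw [hcross]
      exact hdet p hp

theorem intersectionSum_eq {α β : SmoothLoop} {i j k l : ℤ}
    (h : Represents α β (windingLoop i j).cls (windingLoop k l).cls) :
    intersectionSum α β = (i * l - j * k) • word (i + k) (j + l) := by
  obtain ⟨ht, hα, hβ⟩ := h
  have hα' := SmoothLoop.lift_add_one_of_cls_eq hα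
  have hβ' := SmoothLoop.lift_add_one_of_cls_eq hβ
  have : Fintype (SmoothLoop.crossings α β) := ht.1.fintype
  rw [intersectionSum, finsum_eq_sum_of_fintype, ← SmoothLoop.sum_crossingSign hα' hβ' ht,
    Finset.sum_smul]
  refine Finset.sum_congr rfl fun p _ => ?_
  rw [(SmoothLoop.hasWinding_productAt hα' hβ' p).basisElt_eq]

theorem goldmanBracket_basisElt (x y : FreeLoopClass Torus) :
    goldmanBracket (basisElt x) (basisElt y) = bracketOfClasses x y := by
  simp [goldmanBracket, basisElt]

theorem goldmanBracket_word (i j k l : ℤ) :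
    goldmanBracket (word i j) (word k l) = (i * l - j * k) • word (i + k) (j + l) := by
  have h : ∃ r : SmoothLoop × SmoothLoop,
      Represents r.1 r.2 (windingLoop i j).cls (windingLoop k l).cls := by
    obtain ⟨α, β, hαβ⟩ := exists_represents (windingLoop i j).cls (windingLoop k l).cls
    exact ⟨(α, β), hαβ⟩
  rw [word, word, goldmanBracket_basisElt, bracketOfClasses, dif_pos h]
  exact intersectionSum_eq h.choose_spec

theorem bracketWellDefined : BracketWellDefined := by
  refine fun x y => ⟨exists_represents x y, fun α β h => ?_⟩
  obtain ⟨i, j, rfl⟩ := exists_windingLoop_cls_eq x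
  obtain ⟨k, l, rfl⟩ := exists_windingLoop_cls_eq y
  rw [intersectionSum_eq h]
  exact goldmanBracket_word i j k l

/-! ### The Lie algebra axioms, checked on words -/

theorem span_word_eq_top :
    Submodule.span ℤ (Set.range fun p : ℤ × ℤ => word p.1 p.2) = ⊤ := by
  rw [eq_top_iff]
  intro x _
  induction x using Finsupp.induction_linear with
  | zero => exact zero_mem _
  | add f g hf hg => exact add_mem (hf trivial) (hg trivial)
  | single c n =>
    obtain ⟨i, j, rfl⟩ := exists_windingLoop_cls_eq c
    have h : Finsupp.single (windingLoop i j).cls n = n • word i j := by simp [word, basisElt]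
    rw [h]
    exact Submodule.smul_mem _ _ (Submodule.subset_span ⟨(i, j), rfl⟩)

theorem word_hom_ext {M : Type*} [AddCommGroup M] {f g : GoldmanModule →ₗ[ℤ] M}
    (h : ∀ i j, f (word i j) = g (word i j)) : f = g :=
  LinearMap.ext_on span_word_eq_top (by rintro _ ⟨p, rfl⟩; exact h p.1 p.2)

theorem goldmanBracket_skew (x y : GoldmanModule) :
    goldmanBracket x y = -goldmanBracket y x := by
  have h : goldmanBracket = -goldmanBracket.flip := by
    refine word_hom_ext fun i j => word_hom_ext fun k l => ?_
    rw [LinearMap.neg_apply, LinearMap.neg_apply, LinearMap.flip_apply, goldmanBracket_word,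
      goldmanBracket_word, ← neg_smul, add_comm k, add_comm l]
    congr 1
    ring
  exact congrArg (fun B => B x y) h

theorem isLieBracket_goldmanBracket : IsLieBracket goldmanBracket where
  self x := by
    have h := goldmanBracket_skew x x
    have h2 : (2 : ℤ) • goldmanBracket x x = 0 := by
      rw [two_smul]
      nth_rewrite 2 [h]
      exact add_neg_cancel _
    exact (smul_eq_zero.1 h2).resolve_left two_ne_zero
  jacobi x y z := by
    let B := goldmanBracket
    -- Jacobi in Leibniz form is an equality of trilinear maps, hence a polynomial identity between
    -- determinants on words.
    let J₁ : GoldmanModule →ₗ[ℤ] GoldmanModule →ₗ[ℤ] GoldmanModule →ₗ[ℤ] GoldmanModule :=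
      LinearMap.mk₂ ℤ (fun x y => B x ∘ₗ B y - B y ∘ₗ B x) (by intros; ext; simp; abel)
        (by intros; ext; simp [smul_sub]) (by intros; ext; simp; abel)
        (by intros; ext; simp [smul_sub])
    have hJ : J₁ = B.compr₂ B := by
      refine word_hom_ext fun i j => word_hom_ext fun k l => word_hom_ext fun m n => ?_
      simp only [J₁, B, LinearMap.mk₂_apply, LinearMap.sub_apply, LinearMap.comp_apply,
        LinearMap.compr₂_apply, goldmanBracket_word, map_smul, LinearMap.smul_apply, smul_smul]
      rw [add_left_comm k i m, add_left_comm l j n, add_assoc i k m, add_assoc j l n, ← sub_smul]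
      congr 1
      ring
    have h : B x (B y z) - B y (B x z) = B (B x y) z := congrArg (fun J => J x y z) hJ
    change B x (B y z) + B y (B z x) + B z (B x y) = 0
    rw [show B z x = -B x z from goldmanBracket_skew z x,
      show B z (B x y) = -B (B x y) z from goldmanBracket_skew _ _, ← h, map_neg]
    abel

/-! ### The lower central series -/

/-- The span of the multiples `gcd(i, j) aⁱbʲ`. -/
def gcdSpan : Submodule ℤ GoldmanModule :=
  Submodule.span ℤ {x | ∃ i j : ℤ, x = (Int.gcd i j : ℤ) • word i j}

theorem smul_word_mem_gcdSpan {c i j : ℤ} (h : (Int.gcd i j : ℤ) ∣ c) :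
    c • word i j ∈ gcdSpan := by
  obtain ⟨d, rfl⟩ := h
  rw [mul_comm, mul_smul]
  exact Submodule.smul_mem _ _ (Submodule.subset_span ⟨i, j, rfl⟩)

theorem gcdSpan_eq :
    gcdSpan = Submodule.span ℤ
      ({x | ∃ i j : ℤ, x = (Int.gcd i j : ℤ) • word i j} ∪
        {x | ∃ n : ℤ, n ≠ 0 ∧ x = n • word n 0} ∪
        {x | ∃ n : ℤ, n ≠ 0 ∧ x = n • word 0 n}) := by
  refine le_antisymm (Submodule.span_mono fun x hx => Or.inl (Or.inl hx))
    (Submodule.span_le.2 ?_)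
  rintro x ((⟨i, j, rfl⟩ | ⟨n, -, rfl⟩) | ⟨n, -, rfl⟩)
  · exact smul_word_mem_gcdSpan dvd_rfl
  · exact smul_word_mem_gcdSpan (Int.gcd_dvd_left _ _)
  · exact smul_word_mem_gcdSpan (Int.gcd_dvd_right _ _)

theorem goldmanBracket_mem_gcdSpan (x y : GoldmanModule) : goldmanBracket x y ∈ gcdSpan := by
  have h : goldmanBracket.compr₂ gcdSpan.mkQ = 0 := by
    refine word_hom_ext fun i j => word_hom_ext fun k l => ?_
    rw [LinearMap.compr₂_apply, goldmanBracket_word]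
    refine (Submodule.Quotient.mk_eq_zero _).2 (smul_word_mem_gcdSpan ?_)
    have h1 : i * l - j * k = i * (j + l) - j * (i + k) := by ring
    rw [h1]
    exact dvd_sub (Dvd.dvd.mul_left (Int.gcd_dvd_right _ _) _)
      (Dvd.dvd.mul_left (Int.gcd_dvd_left _ _) _)
  exact (Submodule.Quotient.mk_eq_zero _).1 (congrArg (fun B => B x y) h)

/-- With Bézout coefficients `A`, `B`, the vectors `(B, -A)` and `(m - B, n + A)` sum to `(m, n)`
and have determinant `A * m + B * n`, the gcd. The second is primitive, so its gcd factor is 1; this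
factor lets the lemma feed the induction on the series. -/
theorem exists_gcd_smul_word_eq_bracket (m n : ℤ) :
    ∃ i j k l : ℤ, (Int.gcd m n : ℤ) • word m n =
      goldmanBracket (word i j) ((Int.gcd k l : ℤ) • word k l) := by
  by_cases h0 : Int.gcd m n = 0
  · refine ⟨0, 0, 0, 0, by simp [h0]⟩
  have hg : (Int.gcd m n : ℤ) ≠ 0 := by exact_mod_cast h0
  obtain ⟨m', hm⟩ := Int.gcd_dvd_left m n
  obtain ⟨n', hn⟩ := Int.gcd_dvd_right m n
  have hb : m' * Int.gcdA m n + n' * Int.gcdB m n = 1 := by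
    have := Int.gcd_eq_gcd_ab m n
    refine mul_left_cancel₀ hg ?_
    linear_combination -this - Int.gcdA m n * hm - Int.gcdB m n * hn
  have hone : Int.gcd (m - Int.gcdB m n) (n + Int.gcdA m n) = 1 := by
    rw [← Int.isCoprime_iff_gcd_eq_one]
    exact ⟨-n', m', by linear_combination hb + m' * hn - n' * hm⟩
  refine ⟨Int.gcdB m n, -Int.gcdA m n, m - Int.gcdB m n, n + Int.gcdA m n, ?_⟩
  rw [hone, Nat.cast_one, one_smul, goldmanBracket_word]
  have h1 : Int.gcdB m n + (m - Int.gcdB m n) = m := by ring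
  have h2 : -Int.gcdA m n + (n + Int.gcdA m n) = n := by ring
  rw [h1, h2]
  congr 1
  linear_combination Int.gcd_eq_gcd_ab m n

theorem word_ne_zero (i j : ℤ) : word i j ≠ 0 := by
  simp [word, basisElt]

theorem lowerCentralSeries_succ_toSubmodule (k : ℕ) :
    letI : LieRing GoldmanModule := isLieBracket_goldmanBracket.lieRing
    (LieModule.lowerCentralSeries ℤ GoldmanModule GoldmanModule (k + 1)).toSubmodule =
      gcdSpan := by
  let _ : LieRing GoldmanModule := isLieBracket_goldmanBracket.lieRing
  have hmem : ∀ k m n, (Int.gcd m n : ℤ) • word m n ∈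
      LieModule.lowerCentralSeries ℤ GoldmanModule GoldmanModule k := by
    intro k
    induction k with
    | zero => exact fun m n => LieSubmodule.mem_top _
    | succ k ih =>
      intro m n
      obtain ⟨i, j, p, q, h⟩ := exists_gcd_smul_word_eq_bracket m n
      rw [LieModule.lowerCentralSeries_succ, h]
      exact LieSubmodule.lie_mem_lie (LieSubmodule.mem_top (word i j)) (ih p q)
  refine le_antisymm ?_ (Submodule.span_le.2 ?_)
  · rw [LieModule.lowerCentralSeries_succ, LieSubmodule.lieIdeal_oper_eq_linear_span',
      Submodule.span_le]
    rintro _ ⟨x, -, y, -, rfl⟩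
    exact goldmanBracket_mem_gcdSpan x y
  · rintro _ ⟨m, n, rfl⟩
    exact hmem _ m n

end

end Goldman

theorem mainTheorem11 :
    Goldman.BracketWellDefined ∧
    ∃ h : Goldman.IsLieBracket Goldman.goldmanBracket,
      letI : LieRing Goldman.GoldmanModule := h.lieRing
      (∀ k : ℕ,
        LieModule.lowerCentralSeries ℤ Goldman.GoldmanModule Goldman.GoldmanModule (k + 1) =
            ⁅(⊤ : LieIdeal ℤ Goldman.GoldmanModule), (⊤ : LieIdeal ℤ Goldman.GoldmanModule)⁆ ∧
        (LieModule.lowerCentralSeries ℤ Goldman.GoldmanModule Goldman.GoldmanModule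
            (k + 1)).toSubmodule =
          Submodule.span ℤ
            ({x | ∃ i j : ℤ, x = (Int.gcd i j : ℤ) • Goldman.word i j} ∪
              {x | ∃ n : ℤ, n ≠ 0 ∧ x = n • Goldman.word n 0} ∪
              {x | ∃ n : ℤ, n ≠ 0 ∧ x = n • Goldman.word 0 n})) ∧
      ¬ LieRing.IsNilpotent Goldman.GoldmanModule := by
  refine ⟨Goldman.bracketWellDefined, Goldman.isLieBracket_goldmanBracket, ?_⟩
  let _ : LieRing Goldman.GoldmanModule := Goldman.isLieBracket_goldmanBracket.lieRing
  refine ⟨fun k => ⟨?_, ?_⟩, fun hnil => ?_⟩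
  · rw [← LieSubmodule.toSubmodule_inj, Goldman.lowerCentralSeries_succ_toSubmodule k,
      ← Goldman.lowerCentralSeries_succ_toSubmodule 0]
    rfl
  · rw [← Goldman.gcdSpan_eq]
    exact Goldman.lowerCentralSeries_succ_toSubmodule k
  · obtain ⟨k, hk⟩ := (LieModule.isNilpotent_iff ℤ Goldman.GoldmanModule Goldman.GoldmanModule).1
      hnil
    -- The span description starts at index 1, so a vanishing term is pushed one step further.
    have hk' := eq_bot_iff.2 ((LieModule.antitone_lowerCentralSeries ℤ Goldman.GoldmanModule
      Goldman.GoldmanModule (Nat.le_succ k)).trans hk.le)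
    have h := Goldman.lowerCentralSeries_succ_toSubmodule k
    rw [hk'] at h
    have hmem : (1 : ℤ) • Goldman.word 1 0 ∈ Goldman.gcdSpan :=
      Goldman.smul_word_mem_gcdSpan (by simp)
    rw [← h, one_smul] at hmem
    exact Goldman.word_ne_zero 1 0 ((LieSubmodule.mem_bot _).1 hmem)
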